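/- Let $K$ be a field and $S=K[x_1,\ldots,x_N]$, with its usual $\mathbb Z^N$-grading. A Stanley decomposition of a $\mathbb Z^N$-graded $S$-module $M\neq 0$ is a finite direct sum decomposition $\mathcal D:\ M=\bigoplus_{i=1}^r m_iK[Z_i]$ of $\mathbb Z^N$-graded $K$-vector spaces, where each $m_i\in M$ is homogeneous, $Z_i\subseteq\{x_1,\ldots,x_N\}$, and $m_iK[Z_i]=\{um_i : u\in K[Z_i]\}$ is a free $K[Z_i]$-module with basis $m_i$. Put $\operatorname{sdepth}(\mathcal D)=\min_i|Z_i|$, and let the Stanley depth $\operatorname{sdepth}(M)$ be the maximum of $\operatorname{sdepth}(\mathcal D)$ over all Stanley decompositions $\mathcal D$ of $M$. Proposition 2.2. Let $n\ge m\ge 1$ be integers, let $K$ be a field, and let $I=(x_1,\ldots,x_n)\cap(x_{n+1},\ldots,x_{n+m})\subset S=K[x_1,\ldots,x_{n+m}]$, where $I$ and $S/I$ carry the $\mathbb Z^{n+m}$-gradings induced by that of $S$. Then: (1) $m\ge\operatorname{sdepth}(S/I)\ge\min\{m,\lceil n/2\rceil\}$. (2) $m+\lceil n/2\rceil\ge\operatorname{sdepth}(I)\ge\lceil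 n/2\rceil+\lceil m/2\rceil$. (3) If $n\ge 2m-1$, then $\operatorname{sdepth}(S/I)=m$. -/

import Mathlib

open MvPolynomial

noncomputable section

namespace StanleyDepth

/-- For an element `m` of a module `M` over `S = K[x_i : i ∈ σ]` and a set `Z` of variables, the
`K`-subspace `m K[Z] = {u m : u ∈ K[Z]}` of `M`. -/
def stanleySpace {σ K M : Type*} [Field K] [AddCommGroup M] [Module K M]
    [Module (MvPolynomial σ K) M] [IsScalarTower K (MvPolynomial σ K) M]
    (m : M) (Z : Finset σ) : Submodule K M :=
  (Subalgebra.toSubmodule (supported K (Z : Set σ))).map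
    ((LinearMap.toSpanSingleton (MvPolynomial σ K) M m).restrictScalars K)

/-- A Stanley decomposition of a `ℤ^σ`-graded `S`-module `M`, where `S = K[x_i : i ∈ σ]` and
`ℳ a` is the component of `M` of degree `a`: finitely many homogeneous elements `m_i` and sets of
variables `Z_i` such that each `m_i K[Z_i]` is a free `K[Z_i]`-module (with basis `m_i`) and `M` is
the internal direct sum of the subspaces `m_i K[Z_i]`. (These are graded subspaces, as the `m_i`
are homogeneous, so that this is a direct sum of graded vector spaces.) -/
structure StanleyDecomposition {σ K M : Type*} [Field K] [AddCommGroup M] [Module K M]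
    [Module (MvPolynomial σ K) M] [IsScalarTower K (MvPolynomial σ K) M]
    (ℳ : (σ → ℤ) → Submodule K M) where
  /-- the number of summands -/
  r : ℕ
  /-- the generators of the summands -/
  m : Fin r → M
  /-- the sets of variables of the summands -/
  Z : Fin r → Finset σ
  homogeneous : ∀ i, ∃ a : σ → ℤ, m i ∈ ℳ a
  free : ∀ i, ∀ u ∈ supported K (Z i : Set σ), u • m i = 0 → u = 0
  isInternal : DirectSum.IsInternal fun i => stanleySpace (K := K) (m i) (Z i)

/-- The Stanley depth of a decomposition: the minimum of the `|Z_i|`. (If `M ≠ 0` there is at least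
one summand, and this is a genuine minimum.) -/
def StanleyDecomposition.depth {σ K M : Type*} [Field K] [AddCommGroup M] [Module K M]
    [Module (MvPolynomial σ K) M] [IsScalarTower K (MvPolynomial σ K) M]
    {ℳ : (σ → ℤ) → Submodule K M} (D : StanleyDecomposition ℳ) : ℕ :=
  ⨅ i, (D.Z i).card

/-- The Stanley depth of a graded module: the maximum of the depths of its Stanley decompositions.
(The depths are bounded by the number of variables, so that the supremum in `ℕ` is a maximum as soon
as there is a Stanley decomposition.) -/
def sdepth {σ K M : Type*} [Fintype σ] [Field K] [AddCommGroup M] [Module K M]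
    [Module (MvPolynomial σ K) M] [IsScalarTower K (MvPolynomial σ K) M]
    (ℳ : (σ → ℤ) → Submodule K M) : ℕ :=
  sSup (Set.range fun D : StanleyDecomposition ℳ => D.depth)

/-- The component of degree `a ∈ ℤ^σ` of the polynomial ring: the span of the monomial with exponent
vector `a` if `a ≥ 0`, and zero otherwise. -/
def polyGrading (σ K : Type*) [Field K] (a : σ → ℤ) : Submodule K (MvPolynomial σ K) :=
  restrictSupport K {u : σ →₀ ℕ | ∀ i, (u i : ℤ) = a i}

/-- The grading of an ideal `I`, as an `S`-module, induced by that of `S`. -/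
def idealGrading {σ K : Type*} [Field K] (I : Ideal (MvPolynomial σ K)) (a : σ → ℤ) :
    Submodule K I :=
  (polyGrading σ K a).comap ((Submodule.subtype I).restrictScalars K)

/-- The grading of a quotient `S/I` induced by that of `S`. -/
def quotientGrading {σ K : Type*} [Field K] (I : Ideal (MvPolynomial σ K)) (a : σ → ℤ) :
    Submodule K (MvPolynomial σ K ⧸ I) :=
  (polyGrading σ K a).map ((Submodule.mkQ I).restrictScalars K)

/-- The ideal `(x_1, …, x_n) ∩ (x_{n+1}, …, x_{n+m})` of `K[x_1, …, x_{n+m}]`. -/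
def bipartiteIdeal (K : Type*) [Field K] (n m : ℕ) : Ideal (MvPolynomial (Fin (n + m)) K) :=
  Ideal.span (Set.range fun i : Fin n => X (Fin.castAdd m i)) ⊓
    Ideal.span (Set.range fun j : Fin m => X (Fin.natAdd n j))

end StanleyDepth

end

/-! Both `I` and `S/I` have a `K`-basis of monomials, indexed by a set `E` of exponent vectors, and
each multidegree is at most one-dimensional. So a Stanley decomposition amounts to a partition of
`E` into finitely many translated orthants `u + ℕ^Z` (`exists_exponents`,
`exists_stanleyDecomposition`).

Lower bounds: here `E` depends only on supports, so it suffices to partition a family of finite sets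
into intervals `[A, B]` with `B` large (`le_sdepth`). The core case is the nonempty subsets of an
`n`-set, with upper ends of size at least `(n + 1) / 2`. Products of two such partitions treat `I`;
for `S/I` one adds the interval of all sets of `y`'s.

Upper bounds: for `S/I`, the orthant containing `y` has no `x`-direction. For `I`, the orthants
starting at the generators `x_i y` induce an oriented graph on the `x_i`, and some vertex has
out-degree at most `(n - 1) / 2`. -/

open MvPolynomial

noncomputable section

namespace StanleyDepth

/-! ### Interval partitions of families of finite sets -/

/-- The family `𝓔` of finite sets is partitioned into finitely many intervals `[A i, B i]`, all of
whose upper ends have at least `k` elements. -/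
def HasIntervalPartition {α : Type*} (𝓔 : Set (Finset α)) (k : ℕ) : Prop :=
  ∃ (ι : Type) (_ : Fintype ι) (A B : ι → Finset α),
    (∀ i, A i ⊆ B i ∧ k ≤ (B i).card ∧ ∀ C, A i ⊆ C → C ⊆ B i → C ∈ 𝓔) ∧
      ∀ C ∈ 𝓔, ∃! i, A i ⊆ C ∧ C ⊆ B i

theorem HasIntervalPartition.map {α β : Type*} (e : α ≃ β) {𝓔 : Set (Finset α)} {k : ℕ}
    (h : HasIntervalPartition 𝓔 k) :
    HasIntervalPartition {C : Finset β | C.map e.symm.toEmbedding ∈ 𝓔} k := by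
  obtain ⟨ι, _, A, B, h1, h2⟩ := h
  have hl : ∀ (C : Finset β) (D : Finset α),
      D.map e.toEmbedding ⊆ C ↔ D ⊆ C.map e.symm.toEmbedding := by
    intro C D
    constructor
    · intro h x hx
      exact Finset.mem_map.2 ⟨e x, h (Finset.mem_map_of_mem _ hx), by simp⟩
    · intro h x hx
      obtain ⟨y, hy, rfl⟩ := Finset.mem_map.1 hx
      obtain ⟨z, hz, hzy⟩ := Finset.mem_map.1 (h hy)
      rw [← hzy]
      simpa using hz
  have hr : ∀ (C : Finset β) (D : Finset α),
      C ⊆ D.map e.toEmbedding ↔ C.map e.symm.toEmbedding ⊆ D := by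
    intro C D
    constructor
    · intro h x hx
      obtain ⟨y, hy, rfl⟩ := Finset.mem_map.1 hx
      obtain ⟨z, hz, hzy⟩ := Finset.mem_map.1 (h hy)
      rw [← hzy]
      simpa using hz
    · intro h x hx
      exact Finset.mem_map.2 ⟨e.symm x, h (Finset.mem_map_of_mem _ hx), by simp⟩
  refine ⟨ι, inferInstance, fun i => (A i).map e.toEmbedding, fun i => (B i).map e.toEmbedding,
    fun i => ⟨Finset.map_subset_map.2 (h1 i).1, by simpa using (h1 i).2.1, fun C hA hB => ?_⟩,
    fun C hC => ?_⟩
  · exact (h1 i).2.2 _ ((hl _ _).1 hA) ((hr _ _).1 hB)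
  · simp only [hl, hr]
    exact h2 _ hC

/-- The nonempty subsets of a cycle of odd length. The intervals correspond to the tilings of the
cycle by tiles of lengths 1 and 2, where `T` is the set of the first elements of the tiles: the lower
end consists of the tiles of length 1, and the upper end contains in addition the last elements of
the tiles of length 2. -/
theorem hasIntervalPartition_zmod (n : ℕ) [NeZero n] (hn : Odd n) :
    HasIntervalPartition {C : Finset (ZMod n) | C.Nonempty} ((n + 1) / 2) := by
  classical
  let A : Finset (ZMod n) → Finset (ZMod n) := fun T => {i | i ∈ T ∧ i + 1 ∈ T}
  let B : Finset (ZMod n) → Finset (ZMod n) := fun T => {i | i ∈ T → i + 1 ∈ T}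
  have hA : ∀ T i, i ∈ A T ↔ i ∈ T ∧ i + 1 ∈ T := by simp [A]
  have hB : ∀ T i, i ∈ B T ↔ (i ∈ T → i + 1 ∈ T) := by simp [B]
  -- Without a tile of length 1, the complement of `T` would be a translate of `T`, making `n` even.
  have hAn : ∀ T : Finset (ZMod n), (∀ i, i ∉ T → i + 1 ∈ T) → (A T).Nonempty := by
    intro T hT
    by_contra h
    rw [Finset.not_nonempty_iff_eq_empty, Finset.eq_empty_iff_forall_notMem] at h
    have h1 : Tᶜ = T.map (Equiv.addRight (1 : ZMod n)).toEmbedding := by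
      ext i
      simp only [Finset.mem_compl, Finset.mem_map_equiv, Equiv.addRight_symm,
        Equiv.coe_addRight]
      have := hT (i + -1)
      have h' := h (i + -1)
      rw [hA] at h'
      simp only [neg_add_cancel_right] at this h'
      tauto
    have h2 := congrArg Finset.card h1
    rw [Finset.card_map, Finset.card_compl, ZMod.card] at h2
    have h3 : T.card ≤ n := (Finset.card_le_univ T).trans_eq (ZMod.card n)
    obtain ⟨k, rfl⟩ := hn
    omega
  refine ⟨{T : Finset (ZMod n) // ∀ i, i ∉ T → i + 1 ∈ T}, inferInstance, fun T => A T,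
    fun T => B T, ?_, ?_⟩
  · rintro ⟨T, hT⟩
    refine ⟨fun i => ?_, ?_, fun C hC _ => (hAn T hT).mono hC⟩
    · simp only [hA, hB]; tauto
    -- A point outside `B T` starts a tile of length 2, whose last element lies in `B T`; hence `B
    -- T` contains at least half of the cycle.
    · have h1 : (B T)ᶜ.map (Equiv.addRight (1 : ZMod n)).toEmbedding ⊆ B T := by
        intro i hi
        obtain ⟨j, hj, rfl⟩ := Finset.mem_map.1 hi
        rw [Finset.mem_compl, hB] at hj
        rw [hB]
        simp only [Equiv.toEmbedding_apply, Equiv.coe_addRight]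
        tauto
      have h2 := Finset.card_le_card h1
      rw [Finset.card_map, Finset.card_compl, ZMod.card] at h2
      show (n + 1) / 2 ≤ (B T).card
      omega
  · rintro C ⟨c, hc⟩
    -- Being the tiling whose interval contains `C` is a recursion around the cycle: `i + 1` starts
    -- a tile unless `i` starts one and `i ∉ C`.
    have key : ∀ T : Finset (ZMod n),
        ((∀ i, i ∉ T → i + 1 ∈ T) ∧ A T ⊆ C ∧ C ⊆ B T) ↔ ∀ i, i + 1 ∈ T ↔ (i ∉ T ∨ i ∈ C) := by
      intro T
      constructor
      · rintro ⟨h1, h2, h3⟩ i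
        have := h1 i
        have h2 := @h2 i
        have h3 := @h3 i
        rw [hA] at h2
        rw [hB] at h3
        tauto
      · intro h
        refine ⟨fun i hi => (h i).2 (Or.inl hi), fun i hi => ?_, fun i hi => ?_⟩
        · rw [hA] at hi
          have := h i
          tauto
        · rw [hB]
          have := h i
          tauto
    -- Since `c ∈ C`, the recursion forces `c + 1 ∈ T` whatever happens at `c`. Started there, it
    -- determines `T` and closes up consistently after one turn.
    obtain ⟨t, ht0, ht⟩ : ∃ t : ℕ → Prop, t 0 ∧
        ∀ j, t (j + 1) ↔ (¬ t j ∨ (c + 1 + (j : ZMod n)) ∈ C) :=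
      ⟨fun j => Nat.rec (motive := fun _ => Prop) True
        (fun j p => ¬ p ∨ (c + 1 + (j : ZMod n)) ∈ C) j, trivial, fun _ => Iff.rfl⟩
    let T : Finset (ZMod n) := Finset.univ.filter fun i : ZMod n => t (i - (c + 1)).val
    have hTt : ∀ i, i ∈ T ↔ t (i - (c + 1)).val := by simp [T]
    have hT : ∀ i, i + 1 ∈ T ↔ (i ∉ T ∨ i ∈ C) := by
      intro i
      rw [hTt, hTt]
      by_cases hi : i = c
      · subst hi
        simp only [sub_self, ZMod.val_zero, hc, or_true, ht0]
      · have hv : (i + 1 - (c + 1)).val = (i - (c + 1)).val + 1 := by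
          have : i + 1 - (c + 1) = (i - (c + 1)) + 1 := by ring
          rw [this]
          have hlt := ZMod.val_lt (i - (c + 1))
          have hne : (i - (c + 1)).val + 1 ≠ n := by
            intro h
            apply hi
            have h2 := congrArg (Nat.cast : ℕ → ZMod n) h
            push_cast at h2
            rw [ZMod.natCast_self, ZMod.natCast_zmod_val] at h2
            linear_combination h2
          rw [← ZMod.natCast_zmod_val (i - (c + 1))]
          have : (((i - (c + 1)).val : ZMod n) + 1) = (((i - (c + 1)).val + 1 : ℕ) : ZMod n) := by
            push_cast; rfl
          rw [this, ZMod.val_natCast, Nat.mod_eq_of_lt (by omega)]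
          simp
        rw [hv, ht, ZMod.natCast_zmod_val]
        simp
    refine ⟨⟨T, ((key T).2 hT).1⟩, ((key T).2 hT).2, ?_⟩
    rintro ⟨T', hT'⟩ h
    have h' := (key T').1 ⟨hT', h⟩
    refine Subtype.ext ?_
    have hj : ∀ j : ℕ, (c + 1 + (j : ZMod n)) ∈ T' ↔ (c + 1 + (j : ZMod n)) ∈ T := by
      intro j
      induction j with
      | zero => simp [h', hT, hc]
      | succ j ih =>
        push_cast
        rw [← add_assoc, h', hT, ih]
    ext i
    have := hj (i - (c + 1)).val
    rw [ZMod.natCast_zmod_val] at this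
    simpa using this

/-- The sets containing the new point form the single interval from `{none}` to the whole set; the
others keep the old partition. -/
theorem HasIntervalPartition.option {α : Type} [Fintype α] {k : ℕ}
    (h : HasIntervalPartition {C : Finset α | C.Nonempty} k) (hk : k ≤ Fintype.card α + 1) :
    HasIntervalPartition {C : Finset (Option α) | C.Nonempty} k := by
  classical
  obtain ⟨ι, _, A, B, h1, h2⟩ := h
  have hsub : ∀ (C : Finset (Option α)), none ∉ C → C = C.eraseNone.map .some := by
    intro C hC
    rw [Finset.map_some_eraseNone, Finset.erase_eq_of_notMem hC]
  refine ⟨Option ι, inferInstance,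
    fun i => i.elim {none} fun i => (A i).map .some,
    fun i => i.elim Finset.univ fun i => (B i).map .some, ?_, ?_⟩
  · rintro (_ | i)
    · refine ⟨Finset.subset_univ _, by simpa using hk, fun C hC _ => ⟨none, hC (by simp)⟩⟩
    · refine ⟨Finset.map_subset_map.2 (h1 i).1, by simpa using (h1 i).2.1, fun C hC _ => ?_⟩
      have : (A i).Nonempty := (h1 i).2.2 _ subset_rfl (h1 i).1
      exact (this.map (f := .some)).mono hC
  · intro C hC
    by_cases hn : none ∈ C
    · refine ⟨none, ⟨by simpa using hn, Finset.subset_univ _⟩, ?_⟩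
      rintro (_ | i) ⟨_, hi⟩
      · rfl
      · simpa using hi hn
    · rw [hsub C hn] at hC ⊢
      obtain ⟨i, hi, hu⟩ := h2 C.eraseNone (Finset.map_nonempty.1 hC)
      refine ⟨some i, ⟨Finset.map_subset_map.2 hi.1, Finset.map_subset_map.2 hi.2⟩, ?_⟩
      rintro (_ | j) ⟨hj, hj'⟩
      · simp at hj
      · exact congrArg some (hu j ⟨Finset.map_subset_map.1 hj, Finset.map_subset_map.1 hj'⟩)

/-- The nonempty subsets of an `n`-element set can be partitioned into intervals whose upper ends
have at least `n / 2` elements (Biró, Howard, Keller, Trotter, Young). -/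
theorem hasIntervalPartition_nonempty (n : ℕ) :
    HasIntervalPartition {C : Finset (Fin n) | C.Nonempty} ((n + 1) / 2) := by
  have odd : ∀ n : ℕ, Odd n → HasIntervalPartition {C : Finset (Fin n) | C.Nonempty}
      ((n + 1) / 2) := by
    intro n hn
    have : NeZero n := ⟨by rintro rfl; simp at hn⟩
    simpa using (hasIntervalPartition_zmod n hn).map (ZMod.finEquiv n).symm.toEquiv
  rcases Nat.even_or_odd n with hn | hn
  · obtain _ | n := n
    · refine ⟨Empty, inferInstance, nofun, nofun, nofun, fun C hC => ?_⟩
      obtain ⟨x, -⟩ := hC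
      exact x.elim0
    · have hn' : Odd n := by
        by_contra h
        rw [Nat.not_odd_iff_even] at h
        exact (Nat.even_add_one.1 hn) h
      -- Adding a point to an odd set leaves the required bound unchanged.
      have h := ((odd n hn').option (by simp; omega)).map
        (Fintype.equivFinOfCardEq (α := Option (Fin n)) (n := n + 1) (by simp))
      obtain ⟨k, rfl⟩ := hn'
      have e : (2 * k + 1 + 1 + 1) / 2 = (2 * k + 1 + 1) / 2 := by omega
      rw [e]
      simpa using h
  · exact odd n hn

/-- A product of two intervals is an interval, and the sizes of the upper ends add. -/
theorem HasIntervalPartition.sum {α β : Type*} {𝓔 : Set (Finset α)} {𝓕 : Set (Finset β)}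
    {k l : ℕ} (h : HasIntervalPartition 𝓔 k) (h' : HasIntervalPartition 𝓕 l) :
    HasIntervalPartition {C : Finset (α ⊕ β) | C.toLeft ∈ 𝓔 ∧ C.toRight ∈ 𝓕} (k + l) := by
  classical
  obtain ⟨ι, _, A, B, h1, h2⟩ := h
  obtain ⟨κ, _, A', B', h1', h2'⟩ := h'
  have hl : ∀ (C : Finset (α ⊕ β)) (D : Finset α) (D' : Finset β),
      D.disjSum D' ⊆ C ↔ D ⊆ C.toLeft ∧ D' ⊆ C.toRight := by
    intro C D D'
    simp [Finset.subset_iff]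
  have hr : ∀ (C : Finset (α ⊕ β)) (D : Finset α) (D' : Finset β),
      C ⊆ D.disjSum D' ↔ C.toLeft ⊆ D ∧ C.toRight ⊆ D' := by
    intro C D D'
    simp [Finset.subset_iff]
  refine ⟨ι × κ, inferInstance, fun i => (A i.1).disjSum (A' i.2),
    fun i => (B i.1).disjSum (B' i.2), ?_, ?_⟩
  · rintro ⟨i, j⟩
    simp only [hl, hr, Finset.card_disjSum, Finset.toLeft_disjSum, Finset.toRight_disjSum]
    exact ⟨⟨(h1 i).1, (h1' j).1⟩, add_le_add (h1 i).2.1 (h1' j).2.1,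
      fun C hA hB => ⟨(h1 i).2.2 _ hA.1 hB.1, (h1' j).2.2 _ hA.2 hB.2⟩⟩
  · rintro C ⟨hC, hC'⟩
    simp only [hl, hr]
    obtain ⟨i, hi, hu⟩ := h2 _ hC
    obtain ⟨j, hj, hu'⟩ := h2' _ hC'
    refine ⟨(i, j), ⟨⟨hi.1, hj.1⟩, hi.2, hj.2⟩, ?_⟩
    rintro ⟨i', j'⟩ ⟨⟨a, b⟩, c, d⟩
    exact Prod.ext (hu i' ⟨a, c⟩) (hu' j' ⟨b, d⟩)

/-- The subsets of `β` form one interval from `∅` to `β`; what remains are the nonempty subsets of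
`α`. -/
theorem HasIntervalPartition.toLeft_or_toRight {α β : Type*} [Fintype β] {k : ℕ}
    (h : HasIntervalPartition {C : Finset α | C.Nonempty} k) :
    HasIntervalPartition {C : Finset (α ⊕ β) | C.toLeft = ∅ ∨ C.toRight = ∅}
      (min (Fintype.card β) k) := by
  classical
  obtain ⟨ι, _, A, B, h1, h2⟩ := h
  have hl : ∀ (C : Finset (α ⊕ β)) (D : Finset α) (D' : Finset β),
      D.disjSum D' ⊆ C ↔ D ⊆ C.toLeft ∧ D' ⊆ C.toRight := by
    intro C D D'
    simp [Finset.subset_iff]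
  have hr : ∀ (C : Finset (α ⊕ β)) (D : Finset α) (D' : Finset β),
      C ⊆ D.disjSum D' ↔ C.toLeft ⊆ D ∧ C.toRight ⊆ D' := by
    intro C D D'
    simp [Finset.subset_iff]
  refine ⟨Option ι, inferInstance,
    fun i => (i.elim ∅ A).disjSum ∅,
    fun i => i.elim (Finset.disjSum ∅ Finset.univ) fun i => (B i).disjSum ∅, ?_, ?_⟩
  · rintro (_ | i)
    · simp only [Option.elim, hr, Finset.subset_empty, Finset.toLeft_disjSum,
        Finset.toRight_disjSum, Finset.card_disjSum]
      exact ⟨by simp, by simp, fun C _ hC => Or.inl hC.1⟩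
    · simp only [Option.elim, hr, Finset.subset_empty, Finset.toLeft_disjSum,
        Finset.toRight_disjSum, Finset.card_disjSum]
      exact ⟨⟨(h1 i).1, trivial⟩, by simp [(h1 i).2.1], fun C _ hC => Or.inr hC.2⟩
  · intro C hC
    by_cases hn : C.toLeft = ∅
    · refine ⟨none, ?_, ?_⟩
      · simp only [Option.elim, hl, hr, hn]
        simp
      rintro (_ | i)
      · simp
      · simp only [Option.elim, hl, hn, Finset.subset_empty]
        rintro ⟨⟨h, -⟩, -⟩
        have : (A i).Nonempty := (h1 i).2.2 _ subset_rfl (h1 i).1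
        simp [h] at this
    · obtain ⟨i, hi, hu⟩ := h2 C.toLeft (Finset.nonempty_iff_ne_empty.2 hn)
      refine ⟨some i, ?_, ?_⟩
      · simp only [Option.elim, hl, hr, hC.resolve_left hn]
        simp [hi]
      rintro (_ | j)
      · simp only [Option.elim, hr, Finset.subset_empty, hn]
        simp
      · simp only [Option.elim, hl, hr]
        rintro ⟨⟨a, -⟩, b, -⟩
        exact congrArg some (hu j ⟨a, b⟩)

/-! ### Stanley decompositions as partitions of exponent sets -/

theorem isInternal_span_image_iff {K M ι κ : Type*} [Field K] [AddCommGroup M] [Module K M]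
    [DecidableEq κ] (b : Module.Basis ι K M) (F : κ → Set ι) :
    (DirectSum.IsInternal fun k => Submodule.span K (b '' F k)) ↔ ∀ v, ∃! k, v ∈ F k := by
  have hsup : ⨆ k, Submodule.span K (b '' F k) = Submodule.span K (b '' ⋃ k, F k) := by
    rw [Set.image_iUnion, Submodule.span_iUnion]
  have hmem : ∀ (s : Set ι) v, b v ∈ Submodule.span K (b '' s) ↔ v ∈ s := by
    intro s v
    rw [b.mem_span_image, b.repr_self]
    simp
  rw [DirectSum.isInternal_submodule_iff_iSupIndep_and_iSup_eq_top, hsup]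
  constructor
  · rintro ⟨h1, h2⟩ v
    have hv : b v ∈ Submodule.span K (b '' ⋃ k, F k) := h2 ▸ Submodule.mem_top
    rw [hmem, Set.mem_iUnion] at hv
    obtain ⟨k, hk⟩ := hv
    refine ⟨k, hk, fun l hl => ?_⟩
    by_contra hne
    exact b.ne_zero v (Submodule.disjoint_def.1 (h1.pairwiseDisjoint hne) _
      ((hmem _ _).2 hl) ((hmem _ _).2 hk))
  · intro h
    constructor
    · intro k
      have : ⨆ (j) (_ : j ≠ k), Submodule.span K (b '' F j) =
          Submodule.span K (b '' ⋃ (j) (_ : j ≠ k), F j) := by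
        simp_rw [Set.image_iUnion, Submodule.span_iUnion]
      rw [this]
      refine b.linearIndependent.disjoint_span_image (Set.disjoint_left.2 fun v hv hv' => ?_)
      simp only [Set.mem_iUnion] at hv'
      obtain ⟨j, hj, hv'⟩ := hv'
      exact hj ((h v).unique hv' hv)
    · have : ⋃ k, F k = Set.univ :=
        Set.eq_univ_of_forall fun v => Set.mem_iUnion.2 (h v).exists
      rw [this, Set.image_univ, b.span_eq]

theorem toSubmodule_supported {σ K : Type*} [Field K] (Z : Set σ) :
    Subalgebra.toSubmodule (supported K Z) = restrictSupport K {w | ↑w.support ⊆ Z} := by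
  ext p
  rw [Subalgebra.mem_toSubmodule, mem_supported, mem_restrictSupport_iff]
  constructor
  · intro h w hw i hi
    exact h ((mem_vars_iff_mem_support i).2 ⟨w, hw, hi⟩)
  · intro h i hi
    obtain ⟨w, hw, hi⟩ := (mem_vars_iff_mem_support i).1 hi
    exact h hw hi

variable {σ K M : Type*} [Field K] [AddCommGroup M] [Module K M]
    [Module (MvPolynomial σ K) M] [IsScalarTower K (MvPolynomial σ K) M]

theorem stanleySpace_smul {c : K} (hc : c ≠ 0) (m : M) (Z : Finset σ) :
    stanleySpace (K := K) (c • m) Z = stanleySpace m Z := by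
  have h : ((LinearMap.toSpanSingleton (MvPolynomial σ K) M (c • m)).restrictScalars K) =
      c • ((LinearMap.toSpanSingleton (MvPolynomial σ K) M m).restrictScalars K) := by
    ext p
    simp [smul_algebra_smul_comm]
  rw [stanleySpace, h, Submodule.map_smul _ _ _ hc, stanleySpace]

/-- The elements `b v`, `v ∈ E`, are a homogeneous `K`-basis of `M`, where `b v` has degree `v`,
and the monomials act on it by translations of the exponents, as far as these stay in `E`. -/
structure IsMonomialBasis (ℳ : (σ → ℤ) → Submodule K M) (E : Set (σ →₀ ℕ))
    (b : (σ →₀ ℕ) → M) : Prop where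
  eq_zero : ∀ v ∉ E, b v = 0
  monomial_smul : ∀ v ∈ E, ∀ w, monomial w (1 : K) • b v = b (v + w)
  linearIndependent : LinearIndependent K fun v : E => b v
  span_eq_top : ⊤ ≤ Submodule.span K (Set.range fun v : E => b v)
  mem : ∀ v ∈ E, b v ∈ ℳ fun i => (v i : ℤ)
  exists_eq_smul : ∀ a, ∀ x ∈ ℳ a, ∃ (v : σ →₀ ℕ) (c : K), x = c • b v

namespace IsMonomialBasis

variable {ℳ : (σ → ℤ) → Submodule K M} {E : Set (σ →₀ ℕ)} {b : (σ →₀ ℕ) → M}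

/-- The basis indexed by `E`. -/
def basis (h : IsMonomialBasis ℳ E b) : Module.Basis E K M :=
  Module.Basis.mk h.linearIndependent h.span_eq_top

theorem basis_apply (h : IsMonomialBasis ℳ E b) (v : E) : h.basis v = b v := by
  simp [basis]

theorem stanleySpace_eq (h : IsMonomialBasis ℳ E b) {u : σ →₀ ℕ} {Z : Finset σ}
    (hu : ∀ w : σ →₀ ℕ, w.support ⊆ Z → u + w ∈ E) :
    stanleySpace (K := K) (b u) Z =
      Submodule.span K (h.basis '' {v | ∃ w : σ →₀ ℕ, w.support ⊆ Z ∧ (v : σ →₀ ℕ) = u + w}) := by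
  have hu0 : u ∈ E := by simpa using hu 0 (by simp)
  rw [stanleySpace, toSubmodule_supported, restrictSupport_eq_span, Submodule.map_span,
    ← Set.image_comp]
  congr 1
  ext x
  constructor
  · rintro ⟨w, hw, rfl⟩
    have hw' : w.support ⊆ Z := by exact_mod_cast hw
    exact ⟨⟨u + w, hu w hw'⟩, ⟨w, hw', rfl⟩, by simp [basis_apply, h.monomial_smul u hu0]⟩
  · rintro ⟨⟨v, hv⟩, ⟨w, hw, rfl⟩, rfl⟩
    exact ⟨w, by exact_mod_cast hw, by simp [basis_apply, h.monomial_smul u hu0]⟩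

/-- Each homogeneous generator is a scalar multiple of one basis element `b u`. Freeness makes it
nonzero and keeps `u + w` in `E`, since otherwise the monomial of exponent `w` would kill it. -/
theorem exists_exponents (h : IsMonomialBasis ℳ E b) (D : StanleyDecomposition ℳ) :
    ∃ u : Fin D.r → σ →₀ ℕ, (∀ i, ∀ w : σ →₀ ℕ, w.support ⊆ D.Z i → u i + w ∈ E) ∧
      ∀ v ∈ E, ∃! i, ∃ w : σ →₀ ℕ, w.support ⊆ D.Z i ∧ v = u i + w := by
  have h1 : ∀ i, ∃ (v : σ →₀ ℕ) (c : K), D.m i = c • b v := fun i =>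
    (D.homogeneous i).elim fun a ha => h.exists_eq_smul a _ ha
  choose u c huc using h1
  have hm : ∀ i, D.m i ≠ 0 := fun i h0 =>
    one_ne_zero (D.free i 1 (one_mem _) (by rw [h0, smul_zero]))
  have hc : ∀ i, c i ≠ 0 := fun i h0 => hm i (by rw [huc, h0, zero_smul])
  have hu0 : ∀ i, u i ∈ E := fun i => by
    by_contra h0
    exact hm i (by rw [huc, h.eq_zero _ h0, smul_zero])
  have hu : ∀ i, ∀ w : σ →₀ ℕ, w.support ⊆ D.Z i → u i + w ∈ E := by
    intro i w hw
    by_contra h0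
    have hw' : monomial w (1 : K) ∈ supported K (D.Z i : Set σ) := by
      rw [mem_supported, vars_monomial one_ne_zero]
      exact_mod_cast hw
    have := D.free i _ hw' (by
      rw [huc, smul_algebra_smul_comm, h.monomial_smul _ (hu0 i), h.eq_zero _ h0, smul_zero])
    simp at this
  refine ⟨u, hu, ?_⟩
  have hD := D.isInternal
  have hs : (fun i => stanleySpace (K := K) (D.m i) (D.Z i)) = fun i =>
      Submodule.span K (h.basis '' {v | ∃ w : σ →₀ ℕ, w.support ⊆ D.Z i ∧
        (v : σ →₀ ℕ) = u i + w}) := by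
    funext i
    rw [huc, stanleySpace_smul (hc i), h.stanleySpace_eq (hu i)]
  rw [hs, isInternal_span_image_iff] at hD
  exact fun v hv => hD ⟨v, hv⟩

/-- Freeness holds because multiplying `b u` by a polynomial spreads its coefficients over distinct
basis elements `b (u + w)`. -/
theorem exists_stanleyDecomposition (h : IsMonomialBasis ℳ E b) {r : ℕ} (u : Fin r → σ →₀ ℕ)
    (Z : Fin r → Finset σ) (hu : ∀ i, ∀ w : σ →₀ ℕ, w.support ⊆ Z i → u i + w ∈ E)
    (hE : ∀ v ∈ E, ∃! i, ∃ w : σ →₀ ℕ, w.support ⊆ Z i ∧ v = u i + w) :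
    ∃ D : StanleyDecomposition ℳ, D.depth = ⨅ i, (Z i).card := by
  have hu0 : ∀ i, u i ∈ E := fun i => by simpa using hu i 0 (by simp)
  refine ⟨⟨r, fun i => b (u i), Z, fun i => ⟨_, h.mem _ (hu0 i)⟩, ?_, ?_⟩, rfl⟩
  · intro i p hp h0
    rw [mem_supported] at hp
    by_contra hne
    obtain ⟨w, hw⟩ := MvPolynomial.ne_zero_iff.1 hne
    have hsupp : ∀ w ∈ p.support, u i + w ∈ E := fun w hw => hu i w fun j hj => by
      exact_mod_cast hp ((mem_vars_iff_mem_support j).2 ⟨w, hw, hj⟩)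
    have hp' : p • b (u i) = ∑ w ∈ p.support, p.coeff w • b (u i + w) := by
      conv_lhs => rw [p.as_sum, Finset.sum_smul]
      refine Finset.sum_congr rfl fun w _ => ?_
      rw [← h.monomial_smul _ (hu0 i), ← smul_assoc, smul_monomial, smul_eq_mul, mul_one]
    rw [hp', ← Finset.sum_attach] at h0
    have hli := h.linearIndependent.comp
      (fun w : p.support => (⟨u i + w, hsupp w w.2⟩ : E)) (fun w w' hww => by
        exact Subtype.ext (add_left_cancel (Subtype.ext_iff.1 hww)))
    rw [Fintype.linearIndependent_iff] at hli
    exact hw (hli (fun w => p.coeff w) (by simpa using h0) ⟨w, mem_support_iff.2 hw⟩)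
  · have hs : (fun i => stanleySpace (K := K) (b (u i)) (Z i)) = fun i =>
        Submodule.span K (h.basis '' {v | ∃ w : σ →₀ ℕ, w.support ⊆ Z i ∧
          (v : σ →₀ ℕ) = u i + w}) := by
      funext i
      rw [h.stanleySpace_eq (hu i)]
    rw [hs, isInternal_span_image_iff]
    exact fun v => hE v v.2

/-- The interval `[A, B]` gives the summand generated by the squarefree monomial on `A` with
variable set `B`: its monomials are those whose support lies in the interval. -/
theorem le_sdepth [Fintype σ] {𝓔 : Set (Finset σ)}
    (h : IsMonomialBasis ℳ {v | v.support ∈ 𝓔} b) (h𝓔 : 𝓔.Nonempty) {k : ℕ}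
    (hP : HasIntervalPartition 𝓔 k) : k ≤ sdepth ℳ := by
  classical
  obtain ⟨ι, _, A, B, h1, h2⟩ := hP
  let e := (Fintype.equivFin ι).symm
  let u : ι → σ →₀ ℕ := fun i => Finsupp.indicator (A i) fun _ _ => 1
  have hus : ∀ i, (u i).support = A i := fun i => by
    ext j
    simp [u, Finsupp.indicator_apply]
  have hF : ∀ (i) (v : σ →₀ ℕ), (∃ w : σ →₀ ℕ, w.support ⊆ B i ∧ v = u i + w) ↔
      A i ⊆ v.support ∧ v.support ⊆ B i := by
    intro i v
    constructor
    · rintro ⟨w, hw, rfl⟩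
      have : (u i + w).support = A i ∪ w.support := by
        rw [← hus]
        ext j
        simp
        tauto
      rw [this]
      exact ⟨Finset.subset_union_left, Finset.union_subset (h1 i).1 hw⟩
    · rintro ⟨ha, hb⟩
      refine ⟨v - u i, fun j hj => hb ?_, ?_⟩
      · rw [Finsupp.mem_support_iff, Finsupp.tsub_apply] at hj
        rw [Finsupp.mem_support_iff]
        omega
      · rw [add_tsub_cancel_of_le]
        intro j
        by_cases hj : j ∈ A i
        · have := Finsupp.mem_support_iff.1 (ha hj)
          simp [u, Finsupp.indicator_apply, hj]
          omega
        · simp [u, Finsupp.indicator_apply, hj]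
  obtain ⟨D, hD⟩ := h.exists_stanleyDecomposition (fun i => u (e i)) (fun i => B (e i))
    (fun i w hw => by
      have := (hF (e i) (u (e i) + w)).1 ⟨w, hw, rfl⟩
      exact (h1 _).2.2 _ this.1 this.2)
    (fun v hv => by
      simp only [hF]
      exact (e.bijective.existsUnique_iff
        (p := fun i => A i ⊆ v.support ∧ v.support ⊆ B i)).1 (h2 _ hv))
  obtain ⟨C, hC⟩ := h𝓔
  obtain ⟨i, -⟩ := (h2 C hC).exists
  -- An infimum over an empty family of naturals would be `0`.
  have : Nonempty (Fin (Fintype.card ι)) := ⟨e.symm i⟩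
  refine le_csSup_of_le ⟨Fintype.card σ, ?_⟩ ⟨D, rfl⟩ ((le_ciInf fun i => (h1 _).2.1).trans_eq hD.symm)
  rintro _ ⟨D, rfl⟩
  show ⨅ i, (D.Z i).card ≤ _
  rcases isEmpty_or_nonempty (Fin D.r) with hr | ⟨⟨i⟩⟩
  · simp
  · exact ciInf_le_of_le (OrderBot.bddBelow _) i (Finset.card_le_univ _)

theorem sdepth_le [Fintype σ] (h : IsMonomialBasis ℳ E b) {k : ℕ}
    (hk : ∀ (d r : ℕ) (u : Fin r → σ →₀ ℕ) (Z : Fin r → Finset σ), (∀ i, d ≤ (Z i).card) →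
      (∀ i, ∀ w : σ →₀ ℕ, w.support ⊆ Z i → u i + w ∈ E) →
      (∀ v ∈ E, ∃! i, ∃ w : σ →₀ ℕ, w.support ⊆ Z i ∧ v = u i + w) → d ≤ k) :
    sdepth ℳ ≤ k := by
  refine csSup_le' ?_
  rintro _ ⟨D, rfl⟩
  obtain ⟨u, hu, hE⟩ := h.exists_exponents D
  exact hk _ _ u D.Z (fun i => ciInf_le (OrderBot.bddBelow _) i) hu hE

end IsMonomialBasis

/-! ### Monomial bases of monomial ideals and their quotients -/

theorem mem_polyGrading {a : σ → ℤ} {p : MvPolynomial σ K} (hp : p ∈ polyGrading σ K a) :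
    ∃ v c, p = monomial v c := by
  classical
  rw [polyGrading, mem_restrictSupport_iff] at hp
  by_cases h0 : p = 0
  · exact ⟨0, 0, by simp [h0]⟩
  · obtain ⟨v, hv⟩ := MvPolynomial.support_nonempty.2 h0
    refine ⟨v, p.coeff v, ?_⟩
    ext w
    rw [coeff_monomial]
    split_ifs with hvw
    · rw [hvw]
    · by_contra hw
      apply hvw
      ext i
      have h1 := hp hv i
      have h2 := hp (mem_support_iff.2 hw) i
      exact_mod_cast h1.trans h2.symm

theorem monomial_mem_polyGrading (v : σ →₀ ℕ) (c : K) :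
    monomial v c ∈ polyGrading σ K fun i => (v i : ℤ) := by
  rw [polyGrading, mem_restrictSupport_iff]
  intro w hw i
  have := support_monomial_subset (by exact_mod_cast hw)
  simp_all

open Classical in
theorem isMonomialBasis_ideal {I : Ideal (MvPolynomial σ K)} {E : Set (σ →₀ ℕ)}
    (hI : ∀ p, p ∈ I ↔ ∀ v ∈ p.support, v ∈ E) :
    IsMonomialBasis (idealGrading I) E fun v =>
      if hv : v ∈ E then ⟨monomial v 1, (hI _).2 fun w hw => by
        rwa [Finset.mem_singleton.1 (support_monomial_subset hw)]⟩ else 0 := by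
  have hmon : ∀ v (c : K), c ≠ 0 → (monomial v c ∈ I ↔ v ∈ E) := fun v c hc => by
    rw [hI, support_monomial, if_neg hc]
    simp
  refine ⟨fun v hv => dif_neg hv, fun v hv w => ?_, ?_, ?_, fun v hv => ?_, fun a x hx => ?_⟩
  -- `E` is closed under translation because `I` is an ideal.
  · have h1 : monomial (v + w) (1 : K) ∈ I := by
      have := I.mul_mem_left (monomial w 1) ((hmon v 1 one_ne_zero).2 hv)
      rwa [monomial_mul, add_comm w, one_mul] at this
    have h2 := (hmon _ _ one_ne_zero).1 h1
    simp only [hv, h2, dif_pos]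
    ext1
    simp [monomial_mul, add_comm w]
  · refine LinearIndependent.of_comp ((Submodule.subtype I).restrictScalars K) ?_
    have : (⇑((Submodule.subtype I).restrictScalars K) ∘ fun v : E =>
        if hv : (v : σ →₀ ℕ) ∈ E then (⟨monomial v 1, (hmon v 1 one_ne_zero).2 hv⟩ : I) else 0) =
        fun v : E => basisMonomials σ K v := by
      funext v
      simp
    rw [this]
    exact (basisMonomials σ K).linearIndependent.comp _ Subtype.val_injective
  · rintro ⟨p, hp⟩ -
    have hp' := (hI p).1 hp
    have : (⟨p, hp⟩ : I) = ∑ v ∈ p.support.attach, p.coeff v •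
        (⟨monomial v 1, (hmon v 1 one_ne_zero).2 (hp' v v.2)⟩ : I) := by
      ext1
      simp only [Submodule.coe_sum, Submodule.coe_smul_of_tower, smul_monomial, smul_eq_mul, mul_one]
      rw [Finset.sum_attach p.support fun v => monomial v (p.coeff v)]
      exact p.as_sum
    rw [this]
    refine Submodule.sum_mem _ fun v _ => Submodule.smul_mem _ _ (Submodule.subset_span ?_)
    exact ⟨⟨v, hp' v v.2⟩, by simp [hp' v v.2]⟩
  · simp only [hv, dif_pos]
    exact monomial_mem_polyGrading v 1
  · obtain ⟨v, c, hvc⟩ := mem_polyGrading (p := (x : MvPolynomial σ K)) hx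
    by_cases hc : c = 0
    · refine ⟨0, 0, ?_⟩
      ext1
      simp [hvc, hc]
    · have hv : v ∈ E := (hmon v c hc).1 (hvc ▸ x.2)
      refine ⟨v, c, ?_⟩
      simp only [hv, dif_pos]
      ext1
      simp [hvc, smul_monomial]

theorem isMonomialBasis_quotient {I : Ideal (MvPolynomial σ K)} {E : Set (σ →₀ ℕ)}
    (hI : ∀ p, p ∈ I ↔ ∀ v ∈ p.support, v ∉ E) :
    IsMonomialBasis (quotientGrading I) E fun v => Submodule.Quotient.mk (monomial v 1) := by
  have hzero : ∀ v ∉ E, (Submodule.Quotient.mk (monomial v 1) : MvPolynomial σ K ⧸ I) = 0 := by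
    intro v hv
    rw [Submodule.Quotient.mk_eq_zero, hI]
    intro w hw
    rwa [Finset.mem_singleton.1 (support_monomial_subset hw)]
  refine ⟨hzero, fun v _ w => ?_, ?_, ?_, fun v _ => ?_, fun a x hx => ?_⟩
  · rw [← Submodule.Quotient.mk_smul, smul_eq_mul, monomial_mul, add_comm w, one_mul]
  · have hb : LinearIndependent K fun v : E => basisMonomials σ K (v : σ →₀ ℕ) :=
      (basisMonomials σ K).linearIndependent.comp _ Subtype.val_injective
    have := hb.map (f := (Submodule.mkQ I).restrictScalars K) (by
      rw [Submodule.disjoint_def]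
      intro p hp hp'
      have hpI : p ∈ I := by simpa using hp'
      rw [hI] at hpI
      have h2 : Set.range (fun v : E => basisMonomials σ K (v : σ →₀ ℕ)) =
        (monomial · (1 : K)) '' E := by
        ext; simp
      rw [h2, ← restrictSupport_eq_span, mem_restrictSupport_iff] at hp
      rw [← MvPolynomial.support_eq_empty, Finset.eq_empty_iff_forall_notMem]
      exact fun v hv => hpI v hv (hp hv))
    simpa [Function.comp_def] using this
  · intro x _
    obtain ⟨p, rfl⟩ := Submodule.Quotient.mk_surjective I x
    have : (Submodule.Quotient.mk p : MvPolynomial σ K ⧸ I) = ∑ v ∈ p.support, p.coeff v •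
        (Submodule.Quotient.mk (monomial v 1) : MvPolynomial σ K ⧸ I) := by
      conv_lhs => rw [p.as_sum, ← Submodule.mkQ_apply, map_sum]
      refine Finset.sum_congr rfl fun v _ => ?_
      rw [Submodule.mkQ_apply, ← Submodule.Quotient.mk_smul, smul_monomial, smul_eq_mul, mul_one]
    rw [this]
    refine Submodule.sum_mem _ fun v _ => Submodule.smul_mem _ _ ?_
    by_cases hv : v ∈ E
    · exact Submodule.subset_span ⟨⟨v, hv⟩, rfl⟩
    · rw [hzero v hv]
      exact zero_mem _
  · exact ⟨_, monomial_mem_polyGrading v 1, rfl⟩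
  · obtain ⟨p, hp, rfl⟩ := hx
    obtain ⟨v, c, rfl⟩ := mem_polyGrading hp
    refine ⟨v, c, ?_⟩
    rw [← Submodule.Quotient.mk_smul, smul_monomial, smul_eq_mul, mul_one]
    rfl

/-! ### The bounds for the bipartite ideal -/

theorem mem_bipartiteIdeal {K : Type*} [Field K] {n m : ℕ} (p : MvPolynomial (Fin (n + m)) K) :
    p ∈ bipartiteIdeal K n m ↔ ∀ v ∈ p.support,
      (∃ i : Fin n, v (Fin.castAdd m i) ≠ 0) ∧ ∃ j : Fin m, v (Fin.natAdd n j) ≠ 0 := by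
  have h1 : (Set.range fun i : Fin n => (X (Fin.castAdd m i) : MvPolynomial (Fin (n + m)) K)) =
      X '' Set.range (Fin.castAdd m) := by
    rw [← Set.range_comp]; rfl
  have h2 : (Set.range fun j : Fin m => (X (Fin.natAdd n j) : MvPolynomial (Fin (n + m)) K)) =
      X '' Set.range (Fin.natAdd n) := by
    rw [← Set.range_comp]; rfl
  rw [bipartiteIdeal, Ideal.mem_inf, h1, h2, mem_ideal_span_X_image, mem_ideal_span_X_image]
  simp only [Set.exists_range_iff]
  exact ⟨fun h v hv => ⟨h.1 v hv, h.2 v hv⟩,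
    fun h => ⟨fun v hv => (h v hv).1, fun v hv => (h v hv).2⟩⟩

theorem toLeft_map_finSumFinEquiv_symm_nonempty {n m : ℕ} (C : Finset (Fin (n + m))) :
    (C.map finSumFinEquiv.symm.toEmbedding).toLeft.Nonempty ↔
      ∃ i : Fin n, Fin.castAdd m i ∈ C := by
  simp [Finset.Nonempty, Finset.mem_map_equiv]

theorem toRight_map_finSumFinEquiv_symm_nonempty {n m : ℕ} (C : Finset (Fin (n + m))) :
    (C.map finSumFinEquiv.symm.toEmbedding).toRight.Nonempty ↔
      ∃ j : Fin m, Fin.natAdd n j ∈ C := by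
  simp [Finset.Nonempty, Finset.mem_map_equiv]

theorem le_sdepth_quotient_bipartiteIdeal (K : Type*) [Field K] (n m : ℕ) :
    min m ((n + 1) / 2) ≤ sdepth (quotientGrading (bipartiteIdeal K n m)) := by
  have hP := ((hasIntervalPartition_nonempty n).toLeft_or_toRight (β := Fin m)).map finSumFinEquiv
  rw [Fintype.card_fin] at hP
  refine (isMonomialBasis_quotient fun p => ?_).le_sdepth ⟨∅, ?_⟩ hP
  · rw [mem_bipartiteIdeal]
    refine forall₂_congr fun v _ => ?_
    simp only [Set.mem_ofPred_eq, not_or, ← Finset.nonempty_iff_ne_empty,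
      toLeft_map_finSumFinEquiv_symm_nonempty, toRight_map_finSumFinEquiv_symm_nonempty,
      Finsupp.mem_support_iff]
  · refine Or.inl (Finset.not_nonempty_iff_eq_empty.1 ?_)
    rw [toLeft_map_finSumFinEquiv_symm_nonempty]
    simp

theorem le_sdepth_bipartiteIdeal (K : Type*) [Field K] {n m : ℕ} (hn : 1 ≤ n) (hm : 1 ≤ m) :
    (n + 1) / 2 + (m + 1) / 2 ≤ sdepth (idealGrading (bipartiteIdeal K n m)) := by
  have hP := ((hasIntervalPartition_nonempty n).sum (hasIntervalPartition_nonempty m)).map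
    finSumFinEquiv
  refine (isMonomialBasis_ideal fun p => ?_).le_sdepth ⟨Finset.univ, ?_⟩ hP
  · rw [mem_bipartiteIdeal]
    refine forall₂_congr fun v _ => ?_
    simp only [Set.mem_ofPred_eq, toLeft_map_finSumFinEquiv_symm_nonempty,
      toRight_map_finSumFinEquiv_symm_nonempty, Finsupp.mem_support_iff]
  · simp only [Set.mem_ofPred_eq, toLeft_map_finSumFinEquiv_symm_nonempty,
      toRight_map_finSumFinEquiv_symm_nonempty, Finset.mem_univ, exists_const_iff, and_true]
    exact ⟨⟨⟨0, hn⟩⟩, ⟨⟨0, hm⟩⟩⟩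

/-- The summand that contains `y` has its variables among the `y_j`. -/
theorem sdepth_quotient_bipartiteIdeal_le (K : Type*) [Field K] {n m : ℕ} (hm : 1 ≤ m) :
    sdepth (quotientGrading (bipartiteIdeal K n m)) ≤ m := by
  let E : Set (Fin (n + m) →₀ ℕ) := {v | ¬ ((∃ i : Fin n, v (Fin.castAdd m i) ≠ 0) ∧
    ∃ j : Fin m, v (Fin.natAdd n j) ≠ 0)}
  have hE : ∀ v, v ∈ E ↔ ¬ ((∃ i : Fin n, v (Fin.castAdd m i) ≠ 0) ∧
    ∃ j : Fin m, v (Fin.natAdd n j) ≠ 0) := fun v => Iff.rfl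
  refine (isMonomialBasis_quotient (E := E) fun p => ?_).sdepth_le fun d r u Z hd hu huE => ?_
  · simp only [mem_bipartiteIdeal, hE, not_not]
  · let y : Fin m := ⟨0, hm⟩
    have hne : ∀ i : Fin n, Fin.natAdd n y ≠ Fin.castAdd m i := fun i h => by
      have := congrArg Fin.val h
      simp only [Fin.val_natAdd, Fin.val_castAdd] at this
      omega
    obtain ⟨k, w, hw, hk⟩ := (huE (Finsupp.single (Fin.natAdd n y) 1) (by
      rw [hE]
      rintro ⟨⟨i, hi⟩, -⟩
      simp [hne] at hi)).exists
    have hZ : Z k ⊆ Finset.univ.map (Fin.natAddEmb n) := by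
      intro z hz
      induction z using Fin.addCases with
      | right j => simp
      | left i =>
        exfalso
        -- If `x_i` were a variable of this summand, `x_i y` would lie in it, but `x_i y` vanishes
        -- in the quotient.
        refine (hE _).1 (hu k (w + Finsupp.single (Fin.castAdd m i) 1) ?_) ⟨⟨i, ?_⟩, y, ?_⟩
        · refine Finsupp.support_add.trans (Finset.union_subset hw ?_)
          exact Finsupp.support_single_subset.trans (by simpa using hz)
        · simp
        · rw [← add_assoc, ← hk]
          simp
    exact (hd k).trans ((Finset.card_le_card hZ).trans_eq (by simp))

/-- Each product `x_i y` generates a summand, and no `x_i x_j y` lies in two of these summands. -/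
theorem sdepth_bipartiteIdeal_le (K : Type*) [Field K] {n m : ℕ} (hn : 1 ≤ n) (hm : 1 ≤ m) :
    sdepth (idealGrading (bipartiteIdeal K n m)) ≤ m + (n + 1) / 2 := by
  classical
  let E : Set (Fin (n + m) →₀ ℕ) := {v | (∃ i : Fin n, v (Fin.castAdd m i) ≠ 0) ∧
    ∃ j : Fin m, v (Fin.natAdd n j) ≠ 0}
  have hE : ∀ v, v ∈ E ↔ ((∃ i : Fin n, v (Fin.castAdd m i) ≠ 0) ∧
    ∃ j : Fin m, v (Fin.natAdd n j) ≠ 0) := fun v => Iff.rfl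
  refine (isMonomialBasis_ideal (E := E) fun p => ?_).sdepth_le fun d r u Z hd hu huE => ?_
  · simp only [mem_bipartiteIdeal, hE]
  let y : Fin m := ⟨0, hm⟩
  have hne : ∀ (i : Fin n) (j : Fin m), Fin.natAdd n j ≠ Fin.castAdd m i := fun i j h => by
    have := congrArg Fin.val h
    simp only [Fin.val_natAdd, Fin.val_castAdd] at this
    omega
  let x : Fin n → Fin (n + m) →₀ ℕ := fun i => Finsupp.single (Fin.castAdd m i) 1
  let v : Fin n → Fin (n + m) →₀ ℕ := fun i => x i + Finsupp.single (Fin.natAdd n y) 1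
  have hx : Function.Injective x := fun i j hij =>
    Fin.castAdd_injective n m (Finsupp.single_left_injective one_ne_zero hij)
  have hvE : ∀ i, v i ∈ E := fun i => ⟨⟨i, by simp [v, x]⟩, y, by simp [v]⟩
  -- The exponent `u k` of the summand containing `x_i y` divides `x_i y` and lies in `E`; as `x_i
  -- y` is a minimal generator, they agree.
  have hv : ∀ i, ∃ k, u k = v i := by
    intro i
    obtain ⟨k, w, -, hk⟩ := (huE (v i) (hvE i)).exists
    refine ⟨k, ?_⟩
    obtain ⟨⟨i', hi'⟩, j', hj'⟩ := (hE _).1 (by simpa using hu k 0 (by simp))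
    have hk' : ∀ a, v i a = u k a + w a := fun a => by rw [hk]; rfl
    have hvx : ∀ a : Fin n, v i (Fin.castAdd m a) = if a = i then 1 else 0 := fun a => by
      simp [v, x, Finsupp.single_apply, hne, eq_comm]
    have hvy : ∀ a : Fin m, v i (Fin.natAdd n a) = if a = y then 1 else 0 := fun a => by
      simp [v, x, Finsupp.single_apply, (hne _ _).symm, eq_comm]
    have e1 : i' = i := by
      by_contra h
      have := hk' (Fin.castAdd m i')
      rw [hvx, if_neg h] at this
      omega
    have e2 : j' = y := by
      by_contra h
      have := hk' (Fin.natAdd n j')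
      rw [hvy, if_neg h] at this
      omega
    subst e1
    ext a
    have := hk' a
    induction a using Fin.addCases with
    | left a =>
      rw [hvx] at this ⊢
      split_ifs at this ⊢ with h
      · subst h; omega
      · omega
    | right a =>
      rw [hvy] at this ⊢
      split_ifs at this ⊢ with h
      · subst h; rw [← e2] at this ⊢; omega
      · omega
  choose f hf using hv
  -- Read `j ∈ T i` as an arc from `i` to `j`.
  let T : Fin n → Finset (Fin n) := fun i =>
    Finset.univ.filter fun j => j ≠ i ∧ Fin.castAdd m j ∈ Z (f i)
  have hT : ∀ i j, j ∈ T i ↔ j ≠ i ∧ Fin.castAdd m j ∈ Z (f i) := by simp [T]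
  -- Besides `T i`, the set `Z (f i)` can contain only `x_i` and the `m` variables `y_j`.
  have hcard : ∀ i, d ≤ (T i).card + 1 + m := by
    intro i
    have hsub : Z (f i) ⊆ (insert i (T i)).map (Fin.castAddEmb m) ∪
        Finset.univ.map (Fin.natAddEmb n) := by
      intro z hz
      induction z using Fin.addCases with
      | right j => simp
      | left j =>
        refine Finset.mem_union_left _ (Finset.mem_map.2 ⟨j, ?_, rfl⟩)
        rw [Finset.mem_insert, hT]
        tauto
    have h1 := Finset.card_le_card hsub
    have h2 := Finset.card_union_le ((insert i (T i)).map (Fin.castAddEmb m))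
      (Finset.univ.map (Fin.natAddEmb n))
    rw [Finset.card_map, Finset.card_map, Finset.card_univ, Fintype.card_fin] at h2
    have h3 := Finset.card_insert_le i (T i)
    have h4 := hd (f i)
    omega
  have hmem : ∀ i j, j ∈ T i →
      ∃ w : Fin (n + m) →₀ ℕ, w.support ⊆ Z (f i) ∧ v i + x j = u (f i) + w := by
    intro i j hj
    refine ⟨x j, Finsupp.support_single_subset.trans ?_, by rw [hf]⟩
    simpa using ((hT i j).1 hj).2
  have hanti : ∀ i j, j ∈ T i → i ∉ T j := by
    intro i j hj hi
    have h1 := hmem i j hj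
    have h2 := hmem j i hi
    have h3 : v j + x i = v i + x j := by
      simp only [v]
      abel
    rw [h3] at h2
    obtain ⟨w, hw, h4⟩ := h1
    have h5 : v i + x j ∈ E := h4 ▸ hu _ w hw
    have h6 := (huE _ h5).unique ⟨w, hw, h4⟩ h2
    have h7 : v i = v j := by rw [← hf, ← hf, h6]
    exact ((hT i j).1 hj).1 (hx (add_right_cancel h7)).symm
  -- Each ordered pair of distinct indices is hit at most once by an arc or a reversed arc.
  have hpairs : ∑ i, (T i).card + ∑ i, (T i).card ≤ n * (n - 1) := by
    have h1 : ∀ i, (T i).card = ∑ j, if j ∈ T i then 1 else 0 := by simp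
    calc ∑ i, (T i).card + ∑ i, (T i).card
        = ∑ i, ∑ j, ((if j ∈ T i then 1 else 0) + if i ∈ T j then 1 else 0) := by
          simp only [Finset.sum_add_distrib]
          congr 1
          · exact Finset.sum_congr rfl fun i _ => h1 i
          · rw [Finset.sum_comm]
            exact Finset.sum_congr rfl fun i _ => h1 i
      _ ≤ ∑ i : Fin n, ∑ j : Fin n, if j ≠ i then 1 else 0 := by
          refine Finset.sum_le_sum fun i _ => Finset.sum_le_sum fun j _ => ?_
          by_cases hj : j ∈ T i
          · simp [hj, hanti i j hj, ((hT i j).1 hj).1]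
          · by_cases hi : i ∈ T j
            · simp [hj, hi, ((hT j i).1 hi).1.symm]
            · simp [hj, hi]
      _ = n * (n - 1) := by
          simp only [← Finset.card_filter, Finset.filter_ne',
            Finset.card_erase_of_mem (Finset.mem_univ _)]
          simp
  have hsum : n * (d - 1 - m) ≤ ∑ i, (T i).card := by
    have := Finset.card_nsmul_le_sum Finset.univ (fun i => (T i).card) (d - 1 - m)
      fun i _ => by have := hcard i; omega
    simpa using this
  -- Cancelling `n` gives `2 (d - 1 - m) ≤ n - 1`, which is `d ≤ m + (n + 1) / 2` after rounding;
  -- truncated subtraction is harmless, since small `d` satisfy the bound anyway.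
  have : n * (2 * (d - 1 - m)) ≤ n * (n - 1) := by
    calc n * (2 * (d - 1 - m)) = n * (d - 1 - m) + n * (d - 1 - m) := by ring
      _ ≤ _ := (add_le_add hsum hsum).trans hpairs
  have := Nat.le_of_mul_le_mul_left this hn
  omega

theorem natCeil_half (n : ℕ) : ⌈(n : ℚ) / 2⌉₊ = (n + 1) / 2 := by
  refine le_antisymm (Nat.ceil_le.2 ?_) ?_
  · have h : n ≤ 2 * ((n + 1) / 2) := by omega
    have h' : (n : ℚ) ≤ 2 * ((n + 1) / 2 : ℕ) := by exact_mod_cast h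
    linarith
  · have h : (n : ℚ) ≤ 2 * ⌈(n : ℚ) / 2⌉₊ := by linarith [Nat.le_ceil ((n : ℚ) / 2)]
    have h' : n ≤ 2 * ⌈(n : ℚ) / 2⌉₊ := by exact_mod_cast h
    omega

end StanleyDepth

end

theorem proposition2p2 (K : Type*) [Field K] (n m : ℕ) (hm : 1 ≤ m) (hmn : m ≤ n) :
    (StanleyDepth.sdepth (StanleyDepth.quotientGrading (StanleyDepth.bipartiteIdeal K n m)) ≤ m ∧
      min m ⌈(n : ℚ) / 2⌉₊ ≤
        StanleyDepth.sdepth (StanleyDepth.quotientGrading (StanleyDepth.bipartiteIdeal K n m))) ∧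
    (StanleyDepth.sdepth (StanleyDepth.idealGrading (StanleyDepth.bipartiteIdeal K n m)) ≤
        m + ⌈(n : ℚ) / 2⌉₊ ∧
      ⌈(n : ℚ) / 2⌉₊ + ⌈(m : ℚ) / 2⌉₊ ≤
        StanleyDepth.sdepth (StanleyDepth.idealGrading (StanleyDepth.bipartiteIdeal K n m))) ∧
    (2 * m - 1 ≤ n →
      StanleyDepth.sdepth (StanleyDepth.quotientGrading (StanleyDepth.bipartiteIdeal K n m)) = m) :=
  by
  have h1 := StanleyDepth.sdepth_quotient_bipartiteIdeal_le K (n := n) hm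
  have h2 := StanleyDepth.le_sdepth_quotient_bipartiteIdeal K n m
  simp only [StanleyDepth.natCeil_half]
  refine ⟨⟨h1, h2⟩, ⟨StanleyDepth.sdepth_bipartiteIdeal_le K (hm.trans hmn) hm,
    StanleyDepth.le_sdepth_bipartiteIdeal K (hm.trans hmn) hm⟩, fun h => ?_⟩
  rw [min_eq_left (by omega)] at h2
  exact le_antisymm h1 h2
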